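/- Let $k$ be a finite field, let $\sigma$ be an automorphism of $k$, and let $k^\sigma=\{a\in k:\sigma(a)=a\}$ be its fixed subfield. A $\varphi$-module over $k$ is a finite-dimensional $k$-vector space $D$ endowed with an additive map $\varphi:D\to D$ such that $\varphi(\lambda x)=\sigma(\lambda)\varphi(x)$ for all $\lambda\in k$ and $x\in D$; it is called étale if $\varphi$ is injective. Morphisms of $\varphi$-modules are the $k$-linear maps commuting with $\varphi$. Then the category of étale $\varphi$-modules over $k$ is equivalent to the category of finite-dimensional $k^\sigma$-vector spaces endowed with an invertible $k^\sigma$-linear endomorphism, whose morphisms are the $k^\sigma$-linear maps commuting with the given endomorphisms. -/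

import Mathlib

open CategoryTheory

universe u

/-- The subfield `k^σ` of elements fixed by a field automorphism `σ`. -/
abbrev fixedSubfield {k : Type u} [Field k] (σ : k ≃+* k) : Subfield k :=
  RingHom.eqLocusField (σ : k →+* k) (RingHom.id k)

/-- A `φ`-module over `k`: a finite-dimensional `k`-vector space with a `σ`-semilinear
endomorphism `φ`, i.e. an additive map with `φ (a • x) = σ a • φ x`. -/
structure PhiModule (k : Type u) [Field k] (σ : k ≃+* k) where
  carrier : Type u
  [addCommGroup : AddCommGroup carrier]
  [module : Module k carrier]
  [finiteDimensional : FiniteDimensional k carrier]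
  φ : carrier →ₛₗ[(σ : k →+* k)] carrier

namespace PhiModule

attribute [instance] addCommGroup module finiteDimensional

variable {k : Type u} [Field k] {σ : k ≃+* k}

/-- Morphisms of `φ`-modules: the `k`-linear maps commuting with `φ`. -/
@[ext]
structure Hom (D E : PhiModule k σ) where
  toLinearMap : D.carrier →ₗ[k] E.carrier
  comm : ∀ x, toLinearMap (D.φ x) = E.φ (toLinearMap x)

instance : Category (PhiModule k σ) where
  Hom D E := Hom D E
  id D := { toLinearMap := LinearMap.id, comm := fun _ => rfl }
  comp f g :=
    { toLinearMap := g.toLinearMap.comp f.toLinearMap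
      comm := fun x => by simp [f.comm, g.comm] }

/-- A `φ`-module is étale if `φ` is injective. -/
def IsEtale : ObjectProperty (PhiModule k σ) :=
  fun D => Function.Injective D.φ

end PhiModule

/-- The category of étale `φ`-modules: a full subcategory of the category of `φ`-modules. -/
abbrev EtalePhiModule (k : Type u) [Field k] (σ : k ≃+* k) :=
  (PhiModule.IsEtale (k := k) (σ := σ)).FullSubcategory

/-- A finite-dimensional `F`-vector space with an invertible `F`-linear endomorphism. -/
structure InvertibleEndoModule (F : Type u) [Field F] where
  carrier : Type u
  [addCommGroup : AddCommGroup carrier]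
  [module : Module F carrier]
  [finiteDimensional : FiniteDimensional F carrier]
  endo : Module.End F carrier
  isUnit_endo : IsUnit endo

namespace InvertibleEndoModule

attribute [instance] addCommGroup module finiteDimensional

variable {F : Type u} [Field F]

/-- Morphisms: the `F`-linear maps commuting with the endomorphisms. -/
@[ext]
structure Hom (V W : InvertibleEndoModule F) where
  toLinearMap : V.carrier →ₗ[F] W.carrier
  comm : ∀ x, toLinearMap (V.endo x) = W.endo (toLinearMap x)

instance : Category (InvertibleEndoModule F) where
  Hom V W := Hom V W
  id V := { toLinearMap := LinearMap.id, comm := fun _ => rfl }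
  comp f g :=
    { toLinearMap := g.toLinearMap.comp f.toLinearMap
      comm := fun x => by simp [f.comm, g.comm] }

end InvertibleEndoModule

/-!
Let `F = k^σ` and `d = [k : F]`. When `d > 1`, the ring `k[φ, φ⁻¹; σ]` is a nonsplit
Azumaya algebra over `F[T, T⁻¹]`, so the equivalence is not a Morita equivalence of these rings and
exists only for finite-dimensional modules. It is a composite of two contravariant equivalences,
each given by `Hom` into one and the same large object.

That object is an algebraic closure `K` of `k` with an automorphism `s` that extends `σ` and
topologically generates `Gal(K/F)`, so that `s` fixes exactly `F` and `s ^ d` fixes exactly `k`.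
On `k` one has `σ = Frob ^ r` for the Frobenius of `F`, with `r` prime to `d`, but an integral
power of `Frob` on `K` that extends `σ` need not have fixed field `F`. So `s` is taken to be a limit
of powers `Frob ^ e n` along an ultrafilter, where `e n` is a prime congruent to `r` modulo `d` and
greater than `n` (`exists_ringEquiv_iterate_eq_iff`, `exists_isDualizing`).

Now let `E` and `E'` be the fixed fields of `s ^ a` and `s ^ b`. A `φ`-module `D` over `E`, whose
`φ` is semilinear for `s ^ b`, has the dual `Hom(D, K)` of `E`-linear maps `f` with
`f ∘ φ = s ^ b ∘ f`; this is an `E'`-vector space on which `f ↦ s ^ a ∘ f` is semilinear for `s ^ a`.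
Solutions that are independent over `E'` stay independent over `K`
(`IsDualizing.linearIndependent_solutions`), so dualizing does not raise the dimension. If `E` is
finite and `D` is étale, then `φ` has finite order and averaging a linear form over a cycle gives
enough solutions to separate the points of `D` (`IsDualizing.exists_solution_ne_zero`). Hence
`D` embeds in its bidual, whose dimension is no larger, and evaluation is an isomorphism: dualizing
is an equivalence of étale `φ`-modules over `E` with the opposite of those over `E'`
(`IsDualizing.dualEquivalence`).

With `(a, b) = (d, 1)` this is a duality between étale `φ`-modules over `(k, σ)` and étale
`φ`-modules over `(F, id)`, that is, `F`-vector spaces with an invertible endomorphism; with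
`(a, b) = (1, 1)` it is a duality of the latter category with itself. Their composite is covariant.
-/

/-! ### Limits of powers of a locally periodic endomorphism -/

open Function in
/-- If every element of `K` is periodic under `Φ`, then the powers of `Φ` extend to exponents in the
profinite integers. The map `s` is such a power, with an exponent that is a unit and is congruent
to `r` modulo `d`: being a unit makes `s` and `Φ` have the same periods. -/
theorem exists_ringEquiv_iterate_eq_iff {K : Type*} [Field K] (Φ : K →+* K)
    (hΦ : ∀ x, x ∈ periodicPts Φ) {r d : ℕ} (hd : d ≠ 0) (hr : r.Coprime d) :
    ∃ s : K ≃+* K, (∀ N x, (s ^ N) x = x ↔ Φ^[N] x = x) ∧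
      ∀ x, Φ^[d] x = x → s x = Φ^[r] x := by
  choose e he hprime hmod using fun n => Nat.forall_exists_prime_gt_and_modEq n hd hr
  -- A prime `e n > n` is prime to any fixed `m > 0` as soon as `n ≥ m`.
  let U : Ultrafilter ℕ := Filter.hyperfilter ℕ
  have hcop : ∀ m : ℕ, 0 < m → ∀ᶠ n in U, m.Coprime (e n) := by
    intro m hm
    have : ∀ᶠ n in Filter.atTop, m.Coprime (e n) := by
      filter_upwards [Filter.eventually_ge_atTop m] with n hn
      exact ((hprime n).coprime_iff_not_dvd.2
        (Nat.not_dvd_of_pos_of_lt hm (hn.trans_lt (he n)))).symm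
    exact this.filter_mono Nat.hyperfilter_le_atTop
  -- The orbit of `x` is finite, so `Φ^[e n] x` is constant along the ultrafilter.
  have hlim : ∀ x, ∃ y, ∀ᶠ n in U, Φ^[e n] x = y := by
    intro x
    have hfin : {y | ∃ n, Φ^[n] x = y}.Finite := by
      refine ((Set.finite_lt_nat (minimalPeriod Φ x)).image (fun n => Φ^[n] x)).subset ?_
      rintro y ⟨n, rfl⟩
      exact ⟨n % minimalPeriod Φ x, Nat.mod_lt _ (minimalPeriod_pos_of_mem_periodicPts (hΦ x)),
        iterate_mod_minimalPeriod_eq⟩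
    obtain ⟨y, -, hy⟩ := (Ultrafilter.eventually_exists_mem_iff hfin
      (P := fun y n => Φ^[e n] x = y) (f := U)).1
      (Filter.Eventually.of_forall fun n => ⟨_, ⟨e n, rfl⟩, rfl⟩)
    exact ⟨y, hy⟩
  choose f hf using hlim
  have huniq : ∀ {x y}, (∀ᶠ n in U, Φ^[e n] x = y) → f x = y := by
    intro x y h
    obtain ⟨n, h1, h2⟩ := ((hf x).and h).exists
    exact h1.symm.trans h2
  let g : K →+* K :=
    { toFun := f
      map_one' := huniq (.of_forall fun n => iterate_map_one Φ _)
      map_zero' := huniq (.of_forall fun n => iterate_map_zero Φ _)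
      map_mul' := fun x y => huniq (by
        filter_upwards [hf x, hf y] with n hx hy
        rw [iterate_map_mul, hx, hy])
      map_add' := fun x y => huniq (by
        filter_upwards [hf x, hf y] with n hx hy
        rw [iterate_map_add, hx, hy]) }
  have hiter : ∀ N x, ∀ᶠ n in U, g^[N] x = Φ^[e n * N] x := by
    intro N
    induction N with
    | zero => intro x; exact .of_forall fun n => rfl
    | succ N ih =>
      intro x
      filter_upwards [ih (f x), hf x] with n h1 h2
      rw [iterate_succ_apply, Nat.mul_succ, iterate_add_apply, h2]
      exact h1
  have hfix : ∀ N x, g^[N] x = x ↔ Φ^[N] x = x := by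
    intro N x
    obtain ⟨n, h1, h2⟩ := ((hiter N x).and
      (hcop _ (minimalPeriod_pos_of_mem_periodicPts (hΦ x)))).exists
    rw [h1]
    change IsPeriodicPt Φ _ x ↔ IsPeriodicPt Φ _ x
    rw [isPeriodicPt_iff_minimalPeriod_dvd, isPeriodicPt_iff_minimalPeriod_dvd]
    exact h2.dvd_mul_left
  have hbij : Bijective g := by
    refine ⟨g.injective, fun x => ?_⟩
    obtain ⟨m, hm, hx⟩ := hΦ x
    refine ⟨g^[m - 1] x, ?_⟩
    have h := (hfix m x).2 hx
    rwa [← Nat.sub_add_cancel hm, iterate_succ_apply'] at h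
  let s : K ≃+* K := RingEquiv.ofBijective g hbij
  have hs : ∀ (N : ℕ) x, (s ^ N) x = g^[N] x := by
    intro N
    induction N with
    | zero => intro x; rfl
    | succ N ih => intro x; rw [pow_succ, RingAut.mul_apply, ih, iterate_succ_apply]; rfl
  refine ⟨s, fun N x => by rw [hs, hfix], fun x hx => ?_⟩
  refine huniq (.of_forall fun n => ?_)
  have hx' : IsPeriodicPt Φ d x := hx
  rw [← hx'.iterate_mod_apply, hmod n, hx'.iterate_mod_apply]

/-! ### The dualizing automorphism of the algebraic closure -/

theorem FiniteField.pow_card_eq_self_iff_mem_range (E : Type*) {K : Type*} [Field E] [Finite E]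
    [Field K] [Algebra E K] (x : K) :
    x ^ Nat.card E = x ↔ x ∈ Set.range (algebraMap E K) := by
  have := Fintype.ofFinite E
  have hprod : (Polynomial.X ^ Nat.card E - Polynomial.X : Polynomial E) =
      ∏ a : E, (Polynomial.X - Polynomial.C a) := by
    rw [Nat.card_eq_fintype_card]
    have hmonic : (Polynomial.X ^ Fintype.card E - Polynomial.X : Polynomial E).Monic :=
      Polynomial.monic_X_pow_sub (by rw [Polynomial.degree_X]; exact_mod_cast Fintype.one_lt_card)
    have h := Polynomial.prod_multiset_X_sub_C_of_monic_of_roots_card_eq hmonic (by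
      rw [FiniteField.roots_X_pow_card_sub_X,
        FiniteField.X_pow_card_sub_X_natDegree_eq _ Fintype.one_lt_card]
      simp)
    rw [FiniteField.roots_X_pow_card_sub_X] at h
    exact h.symm
  have := congrArg (Polynomial.aeval x) hprod
  simp only [map_sub, map_pow, Polynomial.aeval_X, map_prod, Polynomial.aeval_C] at this
  rw [← sub_eq_zero, this, Finset.prod_eq_zero_iff]
  simp only [Finset.mem_univ, true_and, sub_eq_zero, Set.mem_range, eq_comm (a := x)]

/-- The field `K` with its automorphism `s` is dualizing between `(E, τ)` and `(E', τ')`: the fixed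
fields of `s ^ a` and `s ^ b` are `E` and `E'`, on these `s ^ b` and `s ^ a` restrict to `τ` and
`τ'`, and `s` has elements of every exact period. -/
structure IsDualizing {E E' K : Type*} [Field E] [Field E'] [Field K] [Algebra E K]
    [Algebra E' K] (τ : E ≃+* E) (τ' : E' ≃+* E') (s : K ≃+* K) (a b : ℕ) : Prop where
  left_pos : 0 < a
  right_pos : 0 < b
  left_fixed : ∀ x : K, (s ^ a) x = x ↔ x ∈ Set.range (algebraMap E K)
  right_fixed : ∀ x : K, (s ^ b) x = x ↔ x ∈ Set.range (algebraMap E' K)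
  left_compat : ∀ e : E, (s ^ b) (algebraMap E K e) = algebraMap E K (τ e)
  right_compat : ∀ e : E', (s ^ a) (algebraMap E' K e) = algebraMap E' K (τ' e)
  exists_period : ∀ N : ℕ, 0 < N → ∃ θ : K, ∀ j : ℕ, (s ^ j) θ = θ ↔ N ∣ j

/-- A root of unity of order `q ^ N - 1` has exact period `N` under the `q`-power Frobenius. -/
theorem FiniteField.exists_pow_card_iterate_eq_iff_dvd (F K : Type*) [Field F] [Finite F] [Field K]
    [Algebra F K] [IsAlgClosed K] {N : ℕ} (hN : 0 < N) :
    ∃ θ : K, ∀ j : ℕ, θ ^ (Nat.card F ^ j) = θ ↔ N ∣ j := by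
  have := Fintype.ofFinite F
  have hq : 1 < Nat.card F := Finite.one_lt_card
  have hqN : 1 < Nat.card F ^ N := Nat.one_lt_pow hN.ne' hq
  have hcast : ((Nat.card F : ℕ) : K) = 0 := by
    rw [Nat.card_eq_fintype_card, ← map_natCast (algebraMap F K), FiniteField.cast_card_eq_zero,
      map_zero]
  have : NeZero ((Nat.card F ^ N - 1 : ℕ) : K) := ⟨by
    rw [Nat.cast_sub hqN.le, Nat.cast_pow, hcast, zero_pow hN.ne']
    simp⟩
  obtain ⟨θ, hθ⟩ := HasEnoughRootsOfUnity.exists_primitiveRoot K (Nat.card F ^ N - 1)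
  have hθ0 : θ ≠ 0 := hθ.ne_zero (by omega)
  refine ⟨θ, fun j => ?_⟩
  have hj : 1 ≤ Nat.card F ^ j := Nat.one_le_pow _ _ (by omega)
  have hdvd : Nat.card F ^ N - 1 ∣ Nat.card F ^ j - 1 ↔ N ∣ j := by
    refine ⟨fun h => ?_, Nat.pow_sub_one_dvd_pow_sub_one _⟩
    have h1 := Nat.pow_sub_one_gcd_pow_sub_one (Nat.card F) N j
    rw [Nat.gcd_eq_left h] at h1
    have h2 : 1 ≤ Nat.card F ^ N.gcd j := Nat.one_le_pow _ _ (by omega)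
    exact Nat.gcd_eq_left_iff_dvd.1 (Nat.pow_right_injective hq (by omega : _ ^ _ = _ ^ _))
  rw [← hdvd, ← hθ.pow_eq_one_iff_dvd]
  nth_rewrite 1 [← Nat.sub_add_cancel hj]
  rw [pow_succ, mul_eq_right₀ hθ0]

section
variable {k : Type u} [Field k] [Finite k] (σ : k ≃+* k)

/-- The order of `σ` is the degree of `k` over its fixed field, and `σ` is a power of the Frobenius,
which has the same order: so the exponent is prime to the degree. -/
theorem exists_frobenius_pow_eq :
    ∃ r : ℕ, r.Coprime (Module.finrank (fixedSubfield σ) k) ∧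
      ∀ x, σ x = x ^ (Nat.card (fixedSubfield σ) ^ r) := by
  have := Fintype.ofFinite (fixedSubfield σ)
  let σ' : Gal(k/fixedSubfield σ) := AlgEquiv.ofRingEquiv (f := σ) fun x => x.2
  obtain ⟨r, hr⟩ := (FiniteField.bijective_frobeniusAlgEquivOfAlgebraic_pow
    (fixedSubfield σ) k).2 σ'
  have hord : orderOf σ' = Module.finrank (fixedSubfield σ) k := by
    have hbot : IntermediateField.fixedField (Subgroup.zpowers σ') = ⊥ := by
      rw [eq_bot_iff]
      intro x hx
      have hx' : σ' x = x := hx ⟨σ', Subgroup.mem_zpowers σ'⟩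
      exact IntermediateField.mem_bot.2 ⟨⟨x, hx'⟩, rfl⟩
    have h := IntermediateField.finrank_fixedField_eq_card (Subgroup.zpowers σ')
    rw [hbot, IntermediateField.finrank_bot', Nat.card_zpowers] at h
    exact h.symm
  refine ⟨r, ?_, fun x => ?_⟩
  · have hpos : 0 < Module.finrank (fixedSubfield σ) k := Module.finrank_pos
    have h := orderOf_pow (FiniteField.frobeniusAlgEquivOfAlgebraic (fixedSubfield σ) k) (n := r)
    simp only at hr
    rw [hr, hord, FiniteField.orderOf_frobeniusAlgEquivOfAlgebraic] at h
    have := Nat.div_eq_self.1 h.symm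
    rw [Nat.Coprime, Nat.gcd_comm]
    omega
  · have h := DFunLike.congr_fun hr x
    simp only [AlgEquiv.coe_pow,
      FiniteField.coe_frobeniusAlgEquivOfAlgebraic_iterate] at h
    rw [Nat.card_eq_fintype_card]
    exact h.symm

/-- One automorphism `s` serves both for the duality between `(k, σ)` and `(k^σ, id)` and for the
self-duality of `(k^σ, id)`. -/
theorem exists_isDualizing : ∃ s : AlgebraicClosure k ≃+* AlgebraicClosure k,
    IsDualizing σ (RingEquiv.refl (fixedSubfield σ)) s
      (Module.finrank (fixedSubfield σ) k) 1 ∧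
    IsDualizing (RingEquiv.refl (fixedSubfield σ)) (RingEquiv.refl (fixedSubfield σ)) s 1 1 := by
  set F := fixedSubfield σ with hF
  set K := AlgebraicClosure k
  have := Fintype.ofFinite F
  have hd : 0 < Module.finrank F k := Module.finrank_pos
  have : Algebra.IsAlgebraic F K := Algebra.IsAlgebraic.trans F k K
  obtain ⟨r, hr, hσ⟩ := exists_frobenius_pow_eq σ
  let Φ : K →+* K := (FiniteField.frobeniusAlgHom F K : K →+* K)
  have hΦ : ∀ n x, Φ^[n] x = x ^ (Nat.card F ^ n) := by
    intro n x
    rw [Nat.card_eq_fintype_card]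
    exact congrFun (pow_iterate (Fintype.card F) n) x
  have hper : ∀ x, x ∈ Function.periodicPts Φ := by
    intro x
    have hint : IsIntegral F x := Algebra.IsIntegral.isIntegral x
    have := IntermediateField.adjoin.finiteDimensional hint
    have : Finite (IntermediateField.adjoin F {x}) := Module.finite_of_finite F
    refine ⟨Module.finrank F (IntermediateField.adjoin F {x}), Module.finrank_pos, ?_⟩
    change Φ^[_] x = x
    rw [hΦ, ← Module.natCard_eq_pow_finrank, FiniteField.pow_card_eq_self_iff_mem_range]
    exact ⟨IntermediateField.AdjoinSimple.gen F x, rfl⟩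
  obtain ⟨s, hs, hs'⟩ := exists_ringEquiv_iterate_eq_iff Φ hper hd.ne' hr
  have hfix : ∀ x : K, (s ^ 1) x = x ↔ x ∈ Set.range (algebraMap F K) := fun x => by
    rw [hs, hΦ, pow_one, FiniteField.pow_card_eq_self_iff_mem_range]
  have hfixk : ∀ x : K, (s ^ Module.finrank F k) x = x ↔ x ∈ Set.range (algebraMap k K) :=
    fun x => by
      rw [hs, hΦ, ← Module.natCard_eq_pow_finrank, FiniteField.pow_card_eq_self_iff_mem_range]
  have hfixF : ∀ n (x : F), (s ^ n) (algebraMap F K x) = algebraMap F K x := fun n x => by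
    rw [hs]
    exact Function.iterate_fixed ((FiniteField.frobeniusAlgHom F K).commutes x) n
  have hexists : ∀ N : ℕ, 0 < N → ∃ θ : K, ∀ j : ℕ, (s ^ j) θ = θ ↔ N ∣ j := by
    intro N hN
    obtain ⟨θ, hθ⟩ := FiniteField.exists_pow_card_iterate_eq_iff_dvd F K hN
    exact ⟨θ, fun j => by rw [hs, hΦ, hθ]⟩
  refine ⟨s, ⟨hd, one_pos, hfixk, hfix, fun e => ?_, hfixF _, hexists⟩,
    ⟨one_pos, one_pos, hfix, hfix, hfixF _, hfixF _, hexists⟩⟩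
  rw [pow_one, hs', hΦ, hσ, map_pow]
  rw [← hs]
  exact (hfixk _).2 ⟨e, rfl⟩
end

/-! ### Solution spaces of `φ`-modules -/

theorem Algebra.smulCommClass_of_commSemiring (E E' K : Type*) [CommSemiring E] [CommSemiring E']
    [CommSemiring K] [Algebra E K] [Algebra E' K] : SMulCommClass E E' K :=
  ⟨fun x y z => by simp only [Algebra.smul_def]; ring⟩

attribute [local instance] Algebra.smulCommClass_of_commSemiring

namespace IsDualizing

variable {E E' K : Type u} [Field E] [Field E'] [Field K] [Algebra E K] [Algebra E' K]
  {τ : E ≃+* E} {τ' : E' ≃+* E'} {s : K ≃+* K} {a b : ℕ}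

theorem symm (h : IsDualizing τ τ' s a b) : IsDualizing τ' τ s b a :=
  ⟨h.right_pos, h.left_pos, h.right_fixed, h.left_fixed, h.right_compat, h.left_compat,
    h.exists_period⟩

theorem apply_left (h : IsDualizing τ τ' s a b) (e : E) :
    (s ^ a) (algebraMap E K e) = algebraMap E K e :=
  (h.left_fixed _).2 ⟨e, rfl⟩

/-- The `E`-linear maps `f : D → K` with `f ∘ φ = s ^ b ∘ f`, as an `E'`-subspace of all `E`-linear
maps. -/
def solutions (h : IsDualizing τ τ' s a b) (D : PhiModule E τ) :
    Submodule E' (D.carrier →ₗ[E] K) where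
  carrier := {f | ∀ x, f (D.φ x) = (s ^ b) (f x)}
  zero_mem' x := by simp
  add_mem' hf hg x := by simp [hf x, hg x]
  smul_mem' c f hf x := by
    simp only [LinearMap.smul_apply, Algebra.smul_def, map_mul, h.symm.apply_left, hf x]

/-- The space `h.solutions D` as a type of its own, which keeps instance search from unfolding the
module structure on linear maps. -/
def Solutions (h : IsDualizing τ τ' s a b) (D : PhiModule E τ) : Type u := h.solutions D

instance (h : IsDualizing τ τ' s a b) (D : PhiModule E τ) : AddCommGroup (h.Solutions D) :=
  inferInstanceAs (AddCommGroup (h.solutions D))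

instance (h : IsDualizing τ τ' s a b) (D : PhiModule E τ) : Module E' (h.Solutions D) :=
  inferInstanceAs (Module E' (h.solutions D))

theorem Solutions.ext {h : IsDualizing τ τ' s a b} {D : PhiModule E τ} {f g : h.Solutions D}
    (hfg : ∀ x, f.1 x = g.1 x) : f = g :=
  Subtype.ext (LinearMap.ext hfg)

/-- Evaluation of solutions at a point of `D`. -/
def evalAt (h : IsDualizing τ τ' s a b) (D : PhiModule E τ) (x : D.carrier) :
    h.Solutions D →ₗ[E'] K where
  toFun f := f.1 x
  map_add' _ _ := rfl
  map_smul' _ _ := rfl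

/-- Artin's argument: in a shortest relation over `K` with one coefficient equal to `1`, applying
the inverse of `s ^ b` to the coefficients gives another such relation, so all coefficients lie in the fixed field
`E'`. -/
theorem linearIndependent_solutions (h : IsDualizing τ τ' s a b) (D : PhiModule E τ)
    {ι : Type*} {v : ι → h.Solutions D} (hv : LinearIndependent E' v) :
    LinearIndependent K fun i => (v i).1 := by
  classical
  rw [linearIndependent_iff']
  intro S
  induction S using Finset.induction_on with
  | empty => simp
  | insert j S hj ih =>
    intro c hc
    have hcj : c j = 0 := by
      by_contra hne
      have hrel : ∀ x, (v j).1 x +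
          ∑ i ∈ S, c i / c j * (v i).1 x = 0 := by
        intro x
        have hx := DFunLike.congr_fun hc x
        rw [Finset.sum_insert hj] at hx
        simp only [LinearMap.sum_apply, LinearMap.smul_apply, smul_eq_mul, LinearMap.add_apply,
          LinearMap.zero_apply] at hx
        have : ∀ i, c i / c j * (v i).1 x =
            (c j)⁻¹ * (c i * (v i).1 x) := fun i => by ring
        simp only [this, ← Finset.mul_sum]
        rw [← mul_right_inj' hne, mul_add, mul_inv_cancel_left₀ hne, hx, mul_zero]
      -- Compare the relation at `x` with the one at `φ x`, pulled back by `s ^ b`.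
      have hfix : ∀ i ∈ S, c i / c j - (s ^ b).symm (c i / c j) = 0 := by
        refine ih (fun i => c i / c j - (s ^ b).symm (c i / c j)) (LinearMap.ext fun x => ?_)
        have h1 := hrel x
        have h2 := congrArg (s ^ b).symm (hrel (D.φ x))
        simp only [(v _).2 x, map_add, map_sum, map_mul, RingEquiv.symm_apply_apply,
          map_zero] at h2
        simp only [LinearMap.sum_apply, LinearMap.smul_apply, smul_eq_mul, LinearMap.zero_apply,
          sub_mul, Finset.sum_sub_distrib]
        linear_combination h1 - h2
      have hmem : ∀ i ∈ S, ∃ e : E', algebraMap E' K e = c i / c j := fun i hi =>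
        (h.right_fixed _).1 (by
          rw [← RingEquiv.eq_symm_apply]
          exact sub_eq_zero.1 (hfix i hi))
      choose! e he using hmem
      have hzero : ∑ i ∈ insert j S, (if i = j then 1 else e i) • v i = 0 := by
        refine Solutions.ext fun x => ?_
        have h1 := hrel x
        rw [← Finset.sum_congr rfl fun i hi => congrArg (· * (v i).1 x) (he i hi)] at h1
        change h.evalAt D x _ = h.evalAt D x 0
        rw [Finset.sum_insert hj, if_pos rfl, one_smul, map_add, map_sum, map_zero, ← h1]
        refine congrArg _ (Finset.sum_congr rfl fun i hi => ?_)
        rw [if_neg (ne_of_mem_of_not_mem hi hj), map_smul, Algebra.smul_def]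
        rfl
      simpa using linearIndependent_iff'.1 hv _ _ hzero j (Finset.mem_insert_self j S)
    rw [Finset.sum_insert hj, hcj, zero_smul, zero_add] at hc
    intro i hi
    rcases Finset.mem_insert.1 hi with rfl | hi
    · exact hcj
    · exact ih c hc i hi

theorem rank_solutions_le (h : IsDualizing τ τ' s a b) (D : PhiModule E τ) :
    Module.rank E' (h.Solutions D) ≤ Module.finrank E D.carrier := by
  refine rank_le fun S hS => ?_
  have h1 := (h.linearIndependent_solutions D hS).fintype_card_le_finrank
  rwa [Fintype.card_coe, Module.finrank_linearMap_self] at h1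

instance finiteDimensional_solutions (h : IsDualizing τ τ' s a b) (D : PhiModule E τ) :
    FiniteDimensional E' (h.Solutions D) :=
  Module.rank_lt_aleph0_iff.1 ((h.rank_solutions_le D).trans_lt Cardinal.natCast_lt_aleph0)

theorem finrank_solutions_le (h : IsDualizing τ τ' s a b) (D : PhiModule E τ) :
    Module.finrank E' (h.Solutions D) ≤ Module.finrank E D.carrier :=
  Module.finrank_le_of_rank_le (h.rank_solutions_le D)

/-- The powers of `s ^ b` below `N` are linearly independent on the fixed field of `s ^ (b * N)`:
they are distinct on an element `θ` of exact period `b * N`, and its powers give a Vandermonde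
matrix. -/
theorem exists_sum_mul_ne_zero (h : IsDualizing τ τ' s a b) {N : ℕ} (d : Fin N → K)
    (hd : d ≠ 0) : ∃ c : K, (s ^ (b * N)) c = c ∧
      ∑ j : Fin N, (s ^ (b * (j : ℕ))) c * d j ≠ 0 := by
  have hN : 0 < N := by
    rcases Nat.eq_zero_or_pos N with rfl | hN
    · exact absurd (Subsingleton.elim _ _) hd
    · exact hN
  obtain ⟨θ, hθ⟩ := h.exists_period (b * N) (Nat.mul_pos h.right_pos hN)
  have hinj : Function.Injective fun j : Fin N => (s ^ (b * (j : ℕ))) θ := by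
    have key : ∀ i j : Fin N, i ≤ j → (s ^ (b * (i : ℕ))) θ = (s ^ (b * (j : ℕ))) θ → i = j := by
      intro i j hij heq
      have hadd : b * (j : ℕ) = b * (i : ℕ) + b * ((j : ℕ) - i) := by
        rw [← Nat.mul_add, Nat.add_sub_cancel' hij]
      rw [hadd, pow_add, RingAut.mul_apply] at heq
      have h1 := (hθ _).1 ((s ^ (b * (i : ℕ))).injective heq).symm
      have h2 := Nat.eq_zero_of_dvd_of_lt (Nat.dvd_of_mul_dvd_mul_left h.right_pos h1)
        (lt_of_le_of_lt (Nat.sub_le _ _) j.2)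
      have h3 : (i : ℕ) ≤ j := hij
      exact Fin.ext (by omega)
    intro i j heq
    rcases le_total i j with hij | hij
    · exact key i j hij heq
    · exact (key j i hij heq.symm).symm
  by_contra! hall
  refine hd (Matrix.eq_zero_of_forall_pow_sum_mul_pow_eq_zero hinj fun i => ?_)
  have := hall (θ ^ (i : ℕ)) (by rw [map_pow, (hθ _).2 dvd_rfl])
  simpa only [map_pow, mul_comm] using this

/-- Solutions separate the points of an étale `φ`-module over a finite field. Given a linear form `g`
with `g x ≠ 0` and `N` with `φ ^ N = 1`, the solution is the average over the cycle
`f = ∑ j < N, s ^ (b * j) ∘ (c * g) ∘ φ ^ (N - j)`, where `c` is chosen with `f x ≠ 0`. -/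
theorem exists_solution_ne_zero [Finite E] (h : IsDualizing τ τ' s a b) (D : PhiModule E τ)
    (hD : PhiModule.IsEtale D) {x : D.carrier} (hx : x ≠ 0) :
    ∃ f : h.Solutions D, f.1 x ≠ 0 := by
  have : Finite D.carrier := Module.finite_of_finite E
  obtain ⟨P, hP, hφP⟩ : ∃ P, 0 < P ∧ ∀ y, D.φ^[P] y = y := by
    let e : Equiv.Perm D.carrier := Equiv.ofBijective D.φ (Finite.injective_iff_bijective.1 hD)
    refine ⟨orderOf e, orderOf_pos e, fun y => ?_⟩
    have := DFunLike.congr_fun (pow_orderOf_eq_one e) y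
    rwa [← Equiv.Perm.iterate_eq_pow] at this
  -- The factor `a` ensures that `s ^ (b * N)`, as a power of `s ^ a`, fixes `E`.
  have hφN : ∀ y, D.φ^[P * a] y = y := fun y => by
    rw [Function.iterate_mul]
    exact Function.iterate_fixed (hφP y) a
  have hsN : ∀ e : E, (s ^ (b * (P * a))) (algebraMap E K e) = algebraMap E K e := by
    intro e
    have : ∀ n : ℕ, (s ^ (a * n)) (algebraMap E K e) = algebraMap E K e := by
      intro n
      induction n with
      | zero => rfl
      | succ n ih => rw [Nat.mul_succ, pow_add, RingAut.mul_apply, h.apply_left, ih]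
    rw [show b * (P * a) = a * (b * P) by ring]
    exact this _
  generalize hN : P * a = N at hφN hsN
  have hNpos : 0 < N := hN ▸ Nat.mul_pos hP h.left_pos
  obtain ⟨g, hg⟩ : ∃ g : Module.Dual E D.carrier, g x ≠ 0 := by
    by_contra! hall
    exact hx ((Module.forall_dual_apply_eq_zero_iff E x).1 hall)
  let u : ℕ → D.carrier → K := fun j y => algebraMap E K (g (D.φ^[j] y))
  obtain ⟨c, hc, hsum⟩ := h.exists_sum_mul_ne_zero
    (fun j : Fin N => (s ^ (b * (j : ℕ))) (u (N - j) x)) (fun h0 => hg (by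
      have := congrFun h0 ⟨0, hNpos⟩
      simpa [u, hφN] using this))
  let t : ℕ → D.carrier → K := fun j y => (s ^ (b * j)) (c * u (N - j) y)
  have hstep : ∀ j < N, ∀ y, t (j + 1) (D.φ y) = (s ^ b) (t j y) := by
    intro j hj y
    simp only [t, u]
    rw [← RingAut.mul_apply, ← pow_add, ← Function.iterate_succ_apply,
      show (N - (j + 1)).succ = N - j by omega, Nat.mul_succ, Nat.add_comm]
  have hcycle : ∀ y, t 0 y = t N y := by
    intro y
    simp only [t, u, Nat.sub_zero, Nat.sub_self, hφN, Function.iterate_zero, id, map_mul, hc, hsN,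
      mul_zero, pow_zero, RingAut.one_apply]
  have hiter : ∀ (j : ℕ) (e : E) (y : D.carrier), D.φ^[j] (e • y) = (τ ^ j) e • D.φ^[j] y := by
    intro j e y
    induction j with
    | zero => rfl
    | succ j ih =>
      rw [Function.iterate_succ_apply', ih, Function.iterate_succ_apply', map_smulₛₗ, pow_succ']
      rfl
  have hpow : ∀ (j : ℕ) (e : E),
      (s ^ (b * j)) (algebraMap E K e) = algebraMap E K ((τ ^ j) e) := by
    intro j e
    induction j with
    | zero => rfl
    | succ j ih =>
      rw [Nat.mul_succ, Nat.add_comm, pow_add, RingAut.mul_apply, ih, h.left_compat, pow_succ']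
      rfl
  have htsmul : ∀ j ≤ N, ∀ (e : E) y, t j (e • y) = algebraMap E K e * t j y := by
    intro j hj e y
    simp only [t, u, hiter, map_smul, smul_eq_mul, map_mul]
    rw [hpow, ← RingAut.mul_apply, ← pow_add, Nat.add_sub_cancel' hj, ← hpow, hsN]
    ring
  let f : D.carrier →ₗ[E] K :=
    { toFun := fun y => ∑ j ∈ Finset.range N, t j y
      map_add' := fun y z => by
        rw [← Finset.sum_add_distrib]
        refine Finset.sum_congr rfl fun j _ => ?_
        simp only [t, u, iterate_map_add, map_add, mul_add]
      map_smul' := fun e y => by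
        rw [RingHom.id_apply, Algebra.smul_def, Finset.mul_sum]
        exact Finset.sum_congr rfl fun j hj => htsmul j (Finset.mem_range.1 hj).le e y }
  refine ⟨⟨f, fun y => ?_⟩, ?_⟩
  · change ∑ j ∈ Finset.range N, t j (D.φ y) = (s ^ b) (∑ j ∈ Finset.range N, t j y)
    rw [map_sum, ← Finset.sum_congr rfl fun j hj => hstep j (Finset.mem_range.1 hj) y]
    have h1 := Finset.sum_range_succ (fun j => t j (D.φ y)) N
    rw [Finset.sum_range_succ', hcycle] at h1
    exact (add_right_cancel h1).symm
  · change ∑ j ∈ Finset.range N, t j x ≠ 0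
    rw [Finset.sum_range]
    simpa only [t, map_mul] using hsum

end IsDualizing

/-! ### The duality -/

namespace PhiModule

variable {E : Type u} [Field E] {τ : E ≃+* E}

/-- A linear equivalence commuting with `φ` is an isomorphism of `φ`-modules. -/
def isoOfLinearEquiv {D D' : PhiModule E τ} (e : D.carrier ≃ₗ[E] D'.carrier)
    (he : ∀ x, e (D.φ x) = D'.φ (e x)) : D ≅ D' where
  hom := ⟨e.toLinearMap, he⟩
  inv := ⟨e.symm.toLinearMap, fun x => by simp [LinearEquiv.symm_apply_eq, he]⟩
  hom_inv_id := Hom.ext (LinearMap.ext fun x => e.symm_apply_apply x)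
  inv_hom_id := Hom.ext (LinearMap.ext fun x => e.apply_symm_apply x)

theorem hom_ext_apply {D D' : PhiModule E τ} {f g : D ⟶ D'}
    (h : ∀ x, f.toLinearMap x = g.toLinearMap x) : f = g :=
  Hom.ext (LinearMap.ext h)

end PhiModule

namespace IsDualizing

variable {E E' K : Type u} [Field E] [Field E'] [Field K] [Algebra E K] [Algebra E' K]
  {τ : E ≃+* E} {τ' : E' ≃+* E'} {s : K ≃+* K} {a b : ℕ}

/-- The dual `φ`-module: solutions `f`, with `φ f = s ^ a ∘ f`. -/
def dual (h : IsDualizing τ τ' s a b) (D : PhiModule E τ) : PhiModule E' τ' where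
  carrier := h.Solutions D
  finiteDimensional := h.finiteDimensional_solutions D
  φ :=
    { toFun := fun f =>
        ⟨{ toFun := fun x => (s ^ a) (f.1 x)
           map_add' := fun x y => by rw [map_add, map_add]
           map_smul' := fun e x => by
            rw [map_smul, Algebra.smul_def, map_mul, h.apply_left, RingHom.id_apply,
              Algebra.smul_def] }, fun x => by
          change (s ^ a) (f.1 (D.φ x)) = (s ^ b) ((s ^ a) (f.1 x))
          rw [f.2 x, ← RingAut.mul_apply, ← RingAut.mul_apply, ← pow_add, ← pow_add,
            Nat.add_comm]⟩
      map_add' := fun f g => Solutions.ext fun x => map_add (s ^ a) (f.1 x) (g.1 x)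
      map_smul' := fun e f => Solutions.ext fun x => by
        change (s ^ a) (e • f.1 x) = τ' e • (s ^ a) (f.1 x)
        rw [Algebra.smul_def, map_mul, h.right_compat, Algebra.smul_def] }

theorem isEtale_dual (h : IsDualizing τ τ' s a b) (D : PhiModule E τ) :
    PhiModule.IsEtale (h.dual D) := fun _ _ hfg =>
  Solutions.ext fun x => (s ^ a).injective (congrArg (h.evalAt D x) hfg)

/-- The transpose of a morphism of `φ`-modules. -/
def dualMap (h : IsDualizing τ τ' s a b) {D D' : PhiModule E τ} (g : D ⟶ D') :
    h.dual D' ⟶ h.dual D where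
  toLinearMap :=
    { toFun := fun f => ⟨f.1.comp g.toLinearMap, fun x => by
        rw [LinearMap.comp_apply, g.comm, f.2, LinearMap.comp_apply]⟩
      map_add' := fun _ _ => rfl
      map_smul' := fun _ _ => rfl }
  comm _ := rfl

/-- The evaluation map from a `φ`-module to its bidual. -/
def evalMap (h : IsDualizing τ τ' s a b) (D : PhiModule E τ) : D ⟶ h.symm.dual (h.dual D) where
  toLinearMap :=
    { toFun := fun x => ⟨h.evalAt D x, fun _ => rfl⟩
      map_add' := fun x y => Solutions.ext fun f => map_add f.1 x y
      map_smul' := fun e x => Solutions.ext fun f => map_smul f.1 e x }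
  comm x := Solutions.ext fun f => f.2 x

theorem evalMap_injective [Finite E] (h : IsDualizing τ τ' s a b) (D : PhiModule E τ)
    (hD : PhiModule.IsEtale D) : Function.Injective (h.evalMap D).toLinearMap := by
  rw [injective_iff_map_eq_zero]
  intro x hx
  by_contra hne
  obtain ⟨f, hf⟩ := h.exists_solution_ne_zero D hD hne
  exact hf (congrArg (h.symm.evalAt (h.dual D) f) hx)

theorem finrank_bidual [Finite E] (h : IsDualizing τ τ' s a b) (D : PhiModule E τ)
    (hD : PhiModule.IsEtale D) :
    Module.finrank E D.carrier = Module.finrank E (h.symm.dual (h.dual D)).carrier :=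
  le_antisymm (LinearMap.finrank_le_finrank_of_injective (h.evalMap_injective D hD))
    ((h.symm.finrank_solutions_le (h.dual D)).trans (h.finrank_solutions_le D))

/-- An étale `φ`-module over a finite field is isomorphic to its bidual by evaluation. -/
noncomputable def evalIso [Finite E] (h : IsDualizing τ τ' s a b) (D : EtalePhiModule E τ) :
    D ≅ ⟨h.symm.dual (h.dual D.obj), h.symm.isEtale_dual _⟩ :=
  ObjectProperty.isoMk _ (PhiModule.isoOfLinearEquiv
    (LinearEquiv.ofInjectiveOfFinrankEq (h.evalMap D.obj).toLinearMap
      (h.evalMap_injective D.obj D.property) (h.finrank_bidual D.obj D.property))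
    (h.evalMap D.obj).comm)

/-- Dualizing, as a contravariant functor on étale `φ`-modules. -/
def dualFunctor (h : IsDualizing τ τ' s a b) : EtalePhiModule E τ ⥤ (EtalePhiModule E' τ')ᵒᵖ where
  obj D := Opposite.op ⟨h.dual D.obj, h.isEtale_dual D.obj⟩
  map g := (ObjectProperty.homMk (h.dualMap g.hom)).op
  map_id _ := rfl
  map_comp _ _ := rfl

/-- Dualizing is an anti-equivalence, with quasi-inverse the dualizing functor for the exchanged
fields. -/
noncomputable def dualEquivalence [Finite E] [Finite E'] (h : IsDualizing τ τ' s a b) :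
    EtalePhiModule E τ ≌ (EtalePhiModule E' τ')ᵒᵖ :=
  CategoryTheory.Equivalence.mk h.dualFunctor h.symm.dualFunctor.leftOp
    (NatIso.ofComponents h.evalIso fun _ =>
      ObjectProperty.hom_ext _ (PhiModule.hom_ext_apply fun _ => Solutions.ext fun _ => rfl))
    (NatIso.ofComponents (fun D => (h.symm.evalIso D.unop).op) fun _ =>
      Quiver.Hom.unop_inj (ObjectProperty.hom_ext _
        (PhiModule.hom_ext_apply fun _ => Solutions.ext fun _ => rfl)))

end IsDualizing

/-! ### Spaces with an invertible endomorphism as étale `φ`-modules -/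

namespace InvertibleEndoModule

variable (F : Type u) [Field F]

/-- A space with an invertible endomorphism, as an étale `φ`-module for the identity of `F`. -/
def toEtale : InvertibleEndoModule F ⥤ EtalePhiModule F (RingEquiv.refl F) where
  obj V :=
    { obj :=
        { carrier := V.carrier
          φ := { toFun := V.endo, map_add' := map_add _, map_smul' := map_smul _ } }
      property := ((Module.End.isUnit_iff _).1 V.isUnit_endo).injective }
  map f := ObjectProperty.homMk ⟨f.toLinearMap, f.comm⟩
  map_id _ := rfl
  map_comp _ _ := rfl

/-- An étale `φ`-module for the identity of `F`, as a space with an endomorphism, which is invertible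
because it is injective in finite dimension. -/
def ofEtale : EtalePhiModule F (RingEquiv.refl F) ⥤ InvertibleEndoModule F where
  obj D :=
    let endo : Module.End F D.obj.carrier :=
      { toFun := D.obj.φ, map_add' := map_add _, map_smul' := map_smulₛₗ D.obj.φ }
    { carrier := D.obj.carrier
      endo := endo
      isUnit_endo := (Module.End.isUnit_iff _).2
        ⟨D.property, (LinearMap.injective_iff_surjective (f := endo)).1 D.property⟩ }
  map f := ⟨f.hom.toLinearMap, f.hom.comm⟩
  map_id _ := rfl
  map_comp _ _ := rfl

/-- Étale `φ`-modules for the identity of `F` are the same as spaces with an invertible endomorphism;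
the two passages are inverse to each other on the nose. -/
def equivalenceEtale : InvertibleEndoModule F ≌ EtalePhiModule F (RingEquiv.refl F) :=
  CategoryTheory.Equivalence.mk (toEtale F) (ofEtale F) (Iso.refl _) (Iso.refl _)

end InvertibleEndoModule

theorem mainTheorem3 (k : Type u) [Field k] [Finite k] (σ : k ≃+* k) :
    Nonempty (EtalePhiModule k σ ≌ InvertibleEndoModule (fixedSubfield σ)) := by
  obtain ⟨s, hk, hF⟩ := exists_isDualizing σ
  exact ⟨(hk.dualEquivalence.trans hF.dualEquivalence.symm).trans
    (InvertibleEndoModule.equivalenceEtale (fixedSubfield σ)).symm⟩
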